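/- Let $G$ be a finite group. Write $\Phi(G)$ for its Frattini subgroup, $m(G)$ for the number of maximal subgroups of $G$ and, when $G$ is not cyclic, $\sigma(G)$ for the least positive integer $n$ such that $G$ is the union of $n$ proper subgroups. If $G$ is soluble and non-nilpotent and $\sigma(G)=m(G)$, then $\sigma(G)\neq 3$, and there exist an elementary abelian group $E$ of order $\sigma(G)-1$, a prime $p$, an integer $\alpha>0$ and a faithful action of the cyclic group $\mathbb{Z}_{p^{\alpha}}$ on $E$ by automorphisms such that $G/\Phi(G)\cong E\rtimes\mathbb{Z}_{p^{\alpha}}$, the semidirect product being formed with this action. -/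

import Mathlib

universe u

/-- `G` is the union of `n` proper subgroups. -/
def IsUnionOfProperSubgroups (G : Type u) [Group G] (n : ℕ) : Prop :=
  ∃ H : Fin n → Subgroup G, (∀ i, H i ≠ ⊤) ∧ (⋃ i, (H i : Set G)) = Set.univ

/-- `σ(G)`: the least positive integer `n` such that `G` is the union of `n` proper subgroups.
For a finite group such an `n` exists exactly when `G` is not cyclic; the value is `0` otherwise. -/
noncomputable def coveringNumber (G : Type u) [Group G] : ℕ :=
  sInf {n : ℕ | 0 < n ∧ IsUnionOfProperSubgroups G n}

/-- `m(G)`: the number of maximal subgroups of `G`. -/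
noncomputable def numMaximalSubgroups (G : Type u) [Group G] : ℕ :=
  Nat.card {M : Subgroup G // IsCoatom M}

/-- `E` is an elementary abelian group: abelian, and of exponent dividing some prime. -/
def IsElementaryAbelian (E : Type u) [Group E] : Prop :=
  (∀ x y : E, x * y = y * x) ∧ ∃ r : ℕ, r.Prime ∧ ∀ x : E, x ^ r = 1

/-!
If a maximal subgroup were contained in the union of the others, those would cover `G`; hence
`σ(G) = m(G)` gives each maximal subgroup `X` an element `g` lying in no other one, and a normal
subgroup `K` with `K⟨g⟩ ≠ G` is contained in `X`. For non-normal `X` this applies to `K = G''`, as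
`G''⟨g⟩ = G` would force `G' ≤ G''` against solubility. So `G / core X` has an abelian commutator
subgroup `V`, complemented by the image of `X`, which is abelian, acts faithfully and irreducibly
on `V`, and therefore without nontrivial fixed points: every element outside `V` lies in a
conjugate of that complement.

Choose a maximal subgroup `M` containing `G' · core X`. Looking at the element that a maximal
subgroup shares with no other one, we see that it is `M` or a conjugate of `X`. Consequently
`Φ(G) = core X` and `m(G) = |G : X| + 1`, where `|G : X| = |V|` is not `2` since `X` is not normal,
and the complement of `V` has a unique maximal subgroup, that is, it is cyclic of prime power order.
-/

open Subgroup MulAction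
open scoped Pointwise IsMulCommutative

section Conjugates

variable {G : Type*} [Group G] {X : Subgroup G}

theorem ncard_orbit_conjAct (H : Subgroup G) :
    (orbit (ConjAct G) H).ncard = (normalizer (H : Set G)).index := by
  rw [← index_stabilizer, ← index_comap_of_surjective (stabilizer (ConjAct G) H)
    (f := ConjAct.toConjAct.toMonoidHom) ConjAct.toConjAct.surjective]
  congr 1
  ext g
  exact conjAct_pointwise_smul_iff

theorem isCoatom_conjAct_smul (hX : IsCoatom X) (t : ConjAct G) : IsCoatom (t • X) :=
  (OrderIso.isCoatom_iff (MulDistribMulAction.toMulEquiv G t).mapSubgroup X).2 hX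

theorem eq_of_mem_orbit_conjAct {M : Subgroup G} [hM : M.Normal] (h : M ∈ orbit (ConjAct G) X) :
    M = X := by
  obtain ⟨t, rfl⟩ := mem_orbit_symm.1 h
  exact (hM.conjAct t).symm

theorem ker_conjNormal (H : Subgroup G) [H.Normal] :
    (MulAut.conjNormal : G →* MulAut H).ker = centralizer (H : Set G) := by
  ext g
  simp only [MonoidHom.mem_ker, MulEquiv.ext_iff, Subtype.forall, Subtype.ext_iff,
    MulAut.conjNormal_apply, MulAut.one_apply, mul_inv_eq_iff_eq_mul, mem_centralizer_iff,
    SetLike.mem_coe]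
  exact forall₂_congr fun _ _ => eq_comm

theorem normalizer_eq_self_of_isCoatom (hX : IsCoatom X) (hn : ¬ X.Normal) :
    normalizer (X : Set G) = X :=
  (hX.le_iff.1 le_normalizer).resolve_left fun h => hn (normalizer_eq_top_iff.1 h)

theorem ncard_orbit_conjAct_of_isCoatom (hX : IsCoatom X) (hn : ¬ X.Normal) :
    (orbit (ConjAct G) X).ncard = X.index := by
  rw [ncard_orbit_conjAct, normalizer_eq_self_of_isCoatom hX hn]

end Conjugates

section FiniteGroups

theorem isElementaryAbelian_of_characteristic {E : Type*} [CommGroup E] [Finite E]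
    (h : ∀ K : Subgroup E, K.Characteristic → K = ⊥ ∨ K = ⊤) : IsElementaryAbelian E := by
  cases subsingleton_or_nontrivial E
  · exact ⟨mul_comm, 2, Nat.prime_two, fun _ => Subsingleton.elim _ _⟩
  obtain ⟨p, hp, hdvd⟩ := Nat.exists_prime_and_dvd (Finite.one_lt_card (α := E)).ne'
  have := Fact.mk hp
  obtain ⟨x, hx⟩ := exists_prime_orderOf_dvd_card' p hdvd
  let K : Subgroup E := (powMonoidHom p).ker
  have hK : K.Characteristic := characteristic_iff_le_comap.2 fun φ y hy => by
    simpa [K, MonoidHom.mem_ker, ← map_pow] using hy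
  have hxK : x ∈ K := by
    rw [MonoidHom.mem_ker, powMonoidHom_apply, ← hx, pow_orderOf_eq_one]
  have hbot : K ≠ ⊥ := by
    intro hb
    rw [hb, mem_bot] at hxK
    exact hp.one_lt.ne (by rw [← hx, hxK, orderOf_one])
  have htop : K = ⊤ := (h K hK).resolve_left hbot
  exact ⟨mul_comm, p, hp, fun y => MonoidHom.mem_ker.1 (htop ▸ mem_top y : y ∈ K)⟩

variable {C : Type*} [Group C]

theorem isCyclic_of_existsUnique_isCoatom [IsCoatomic (Subgroup C)]
    (h : ∃! M : Subgroup C, IsCoatom M) : IsCyclic C := by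
  obtain ⟨M, hM, huniq⟩ := h
  obtain ⟨g, hg⟩ := SetLike.exists_not_mem_of_ne_top M hM.1
  refine isCyclic_iff_exists_zpowers_eq_top.2
    ⟨g, (eq_top_or_exists_le_coatom _).resolve_right fun ⟨K, hK, hle⟩ => hg ?_⟩
  exact huniq K hK ▸ hle (mem_zpowers g)

theorem isPrimePow_card_of_existsUnique_isCoatom [Finite C]
    (h : ∃! M : Subgroup C, IsCoatom M) : IsPrimePow (Nat.card C) := by
  obtain ⟨M, hM, huniq⟩ := h
  obtain ⟨p, hp, hdvd⟩ := Nat.exists_prime_and_dvd fun h1 => hM.1 (index_eq_one.1 h1)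
  have := Fact.mk hp
  let P : Sylow p C := default
  -- `p` divides `M.index`, so `P` is not contained in `M`, hence in no proper subgroup.
  have htop : (P : Subgroup C) = ⊤ :=
    (eq_top_or_exists_le_coatom _).resolve_right fun ⟨K, hK, hle⟩ =>
      P.not_dvd_index (hdvd.trans (huniq K hK ▸ index_dvd_of_le hle))
  have hP : IsPGroup p C := IsPGroup.of_equiv (htop ▸ P.isPGroup') topEquiv
  obtain ⟨k, hk⟩ := IsPGroup.iff_card.1 hP
  refine (isPrimePow_nat_iff _).2 ⟨p, k, hp, Nat.pos_of_ne_zero ?_, hk.symm⟩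
  rintro rfl
  have hcard : p ∣ Nat.card C := hdvd.trans (index_dvd_card M)
  rw [hk, pow_zero] at hcard
  exact hp.not_dvd_one hcard

theorem exists_zmod_mulEquiv_of_existsUnique_isCoatom [Finite C]
    (h : ∃! M : Subgroup C, IsCoatom M) :
    ∃ p α : ℕ, p.Prime ∧ 0 < α ∧ Nonempty (Multiplicative (ZMod (p ^ α)) ≃* C) := by
  obtain ⟨p, α, hp, hα, hcard⟩ :=
    (isPrimePow_nat_iff _).1 (isPrimePow_card_of_existsUnique_isCoatom h)
  have hcyc := isCyclic_of_existsUnique_isCoatom h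
  exact ⟨p, α, hp, hα, ⟨hcard ▸ zmodCyclicMulEquiv hcyc⟩⟩

end FiniteGroups

/-- `X` is a point stabiliser, and `V` an abelian normal subgroup, of a primitive permutation
group: `X` is a core-free maximal subgroup and `V` is nontrivial. The action of `Q` on `Q ⧸ X` is
then of affine type, with `V` as its group of translations. -/
structure IsAffinePrimitive {Q : Type*} [Group Q] (V X : Subgroup Q) : Prop where
  normal : V.Normal
  isMulCommutative : IsMulCommutative V
  ne_bot : V ≠ ⊥
  isCoatom : IsCoatom X
  normalCore_eq_bot : X.normalCore = ⊥

namespace IsAffinePrimitive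

variable {Q : Type*} [Group Q] {V X T : Subgroup Q}

theorem eq_bot_of_normal_le (h : IsAffinePrimitive V X) (hT : T.Normal) (hle : T ≤ X) : T = ⊥ :=
  le_bot_iff.1 (h.normalCore_eq_bot ▸ (normal_le_normalCore (hN := hT)).2 hle)

theorem sup_eq_top_of_normal (h : IsAffinePrimitive V X) (hT : T.Normal) (hne : T ≠ ⊥) :
    T ⊔ X = ⊤ :=
  h.isCoatom.2 _ (right_lt_sup.2 fun hle => hne (h.eq_bot_of_normal_le hT hle))

theorem sup_eq_top (h : IsAffinePrimitive V X) : V ⊔ X = ⊤ :=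
  h.sup_eq_top_of_normal h.normal h.ne_bot

theorem le_normalizer_of_le (h : IsAffinePrimitive V X) (hT : T ≤ V) :
    V ≤ normalizer (T : Set Q) := by
  have := h.isMulCommutative
  exact (le_centralizer V).trans ((centralizer_le hT).trans (centralizer_le_normalizer _))

theorem normal_of_le_normalizer (h : IsAffinePrimitive V X) (hV : V ≤ normalizer (T : Set Q))
    (hX : X ≤ normalizer (T : Set Q)) : T.Normal :=
  normalizer_eq_top_iff.1 (top_le_iff.1 (h.sup_eq_top ▸ sup_le hV hX))

theorem inf_eq_bot (h : IsAffinePrimitive V X) : V ⊓ X = ⊥ := by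
  have := h.normal
  refine h.eq_bot_of_normal_le (h.normal_of_le_normalizer (h.le_normalizer_of_le inf_le_left) ?_)
    inf_le_right
  exact (le_inf le_normalizer_of_normal le_normalizer).trans inf_normalizer_le_normalizer_inf

theorem isComplement' (h : IsAffinePrimitive V X) : V.IsComplement' X := by
  have := h.normal
  refine isComplement'_of_disjoint_and_mul_eq_univ (disjoint_iff.2 h.inf_eq_bot) ?_
  rw [← normal_mul, h.sup_eq_top, coe_top]

theorem isMulCommutative_right (h : IsAffinePrimitive V X) (hV : commutator Q ≤ V) :
    IsMulCommutative X := by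
  rw [← commutator_self_eq_bot_iff, ← le_bot_iff, ← h.inf_eq_bot]
  exact le_inf ((commutator_mono le_top le_top).trans hV) X.commutator_le_self

theorem card_eq_index (h : IsAffinePrimitive V X) : Nat.card V = X.index :=
  h.isComplement'.index_eq_card.symm

theorem eq_bot_or_eq_of_normal_le (h : IsAffinePrimitive V X) (hT : T.Normal) (hle : T ≤ V) :
    T = ⊥ ∨ T = V := by
  refine or_iff_not_imp_left.2 fun hne => hle.antisymm ?_
  intro v hv
  obtain ⟨t, ht, x, hx, rfl⟩ :=
    mem_sup_of_normal_left.1 (h.sup_eq_top_of_normal hT hne ▸ mem_top v)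
  have hx1 : x ∈ V ⊓ X := ⟨(V.mul_mem_cancel_left (hle ht)).1 hv, hx⟩
  rw [h.inf_eq_bot, mem_bot] at hx1
  rwa [hx1, mul_one]

theorem isElementaryAbelian [Finite V] (h : IsAffinePrimitive V X) : IsElementaryAbelian V := by
  have := h.isMulCommutative
  have := h.normal
  refine isElementaryAbelian_of_characteristic fun K hK => ?_
  refine (h.eq_bot_or_eq_of_normal_le (T := K.map V.subtype) inferInstance
    (map_subtype_le K)).imp (fun hbot => ?_) fun htop => ?_
  · exact (map_eq_bot_iff_of_injective K V.subtype_injective).1 hbot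
  · exact map_injective V.subtype_injective
      (htop.trans (V.range_subtype.symm.trans (MonoidHom.range_eq_map _)))

theorem inf_centralizer_eq_bot (h : IsAffinePrimitive V X) : X ⊓ centralizer (V : Set Q) = ⊥ := by
  have := h.normal
  refine h.eq_bot_of_normal_le (h.normal_of_le_normalizer ?_ ?_) inf_le_left
  · refine le_trans ?_ (centralizer_le_normalizer _)
    exact le_centralizer_iff.1 inf_le_right
  · exact (le_inf le_normalizer le_normalizer_of_normal).trans inf_normalizer_le_normalizer_inf

theorem exists_semidirectProduct {A : Type*} [Group A] (h : IsAffinePrimitive V X) (e : A ≃* X) :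
    ∃ φ : A →* MulAut V, Function.Injective φ ∧ Nonempty (Q ≃* V ⋊[φ] A) := by
  have := h.normal
  have hker : ((MulAut.conjNormal : Q →* MulAut V).comp X.subtype).ker = ⊥ := by
    rw [← MonoidHom.comap_ker, ker_conjNormal, ← subgroupOf, subgroupOf_eq_bot, disjoint_iff,
      inf_comm, h.inf_centralizer_eq_bot]
  refine ⟨(MulAut.conjNormal.comp X.subtype).comp e.toMonoidHom,
    ((MonoidHom.ker_eq_bot_iff _).1 hker).comp e.injective, ⟨?_⟩⟩
  exact (SemidirectProduct.mulEquivSubgroup h.isComplement').symm.trans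
    (SemidirectProduct.congr (MulEquiv.refl V) e fun _ => rfl).symm

theorem inf_centralizer_singleton_eq_bot [IsMulCommutative X] (h : IsAffinePrimitive V X) {x : Q}
    (hx : x ∈ X) (hx1 : x ≠ 1) : V ⊓ centralizer {x} = ⊥ := by
  have := h.normal
  have hXx : X ≤ centralizer {x} := fun z hz =>
    mem_centralizer_singleton_iff.2 (setLike_mul_comm hz hx)
  have hX : X ≤ normalizer ((V ⊓ centralizer {x} : Subgroup Q) : Set Q) :=
    (le_inf le_normalizer_of_normal (hXx.trans le_normalizer)).trans
      inf_normalizer_le_normalizer_inf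
  have hnormal := h.normal_of_le_normalizer (h.le_normalizer_of_le inf_le_left) hX
  refine (h.eq_bot_or_eq_of_normal_le hnormal inf_le_left).resolve_right fun hV => hx1 ?_
  have hxV : x ∈ X ⊓ centralizer (V : Set Q) :=
    ⟨hx, fun _ hv => mem_centralizer_singleton_iff.1 (inf_eq_left.1 hV hv)⟩
  rwa [h.inf_centralizer_eq_bot, mem_bot] at hxV

theorem fixedPointFree_conjNormal [V.Normal] [IsMulCommutative X] (h : IsAffinePrimitive V X)
    {x : Q} (hx : x ∈ X) (hx1 : x ≠ 1) :
    MonoidHom.FixedPointFree (MulAut.conjNormal x : MulAut V) := by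
  intro v hv
  have hcomm : x * v = v * x := mul_inv_eq_iff_eq_mul.1 (congrArg Subtype.val hv)
  have hmem : (v : Q) ∈ V ⊓ centralizer {x} :=
    ⟨v.2, mem_centralizer_singleton_iff.2 hcomm.symm⟩
  rw [h.inf_centralizer_singleton_eq_bot hx hx1, mem_bot] at hmem
  exact Subtype.ext hmem

theorem exists_mem_conjAct_smul [Finite V] [IsMulCommutative X] (h : IsAffinePrimitive V X) {y : Q}
    (hy : y ∉ V) : ∃ t : ConjAct Q, y ∈ t • X := by
  have := h.normal
  obtain ⟨v, hv, x, hx, rfl⟩ := mem_sup_of_normal_left.1 (h.sup_eq_top ▸ mem_top y)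
  have hx1 : x ≠ 1 := fun hx1 => hy (by rwa [hx1, mul_one])
  obtain ⟨u, hu⟩ := (h.fixedPointFree_conjNormal hx hx1).commutatorMap_surjective ⟨v, hv⟩
  have huv : (u : Q) * (x * u * x⁻¹)⁻¹ = v := by
    rw [← div_eq_mul_inv]
    exact congrArg Subtype.val hu
  refine ⟨ConjAct.toConjAct (u : Q), x, hx, ?_⟩
  calc (u : Q) * x * (u : Q)⁻¹ = u * (x * u * x⁻¹)⁻¹ * x := by group
    _ = v * x := by rw [huv]

end IsAffinePrimitive

section Quotients

variable {G H : Type*} [Group G] [Group H] {f : G →* H}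

theorem isCoatom_map_of_surjective (hf : Function.Surjective f) {X : Subgroup G}
    (hker : f.ker ≤ X) (hX : IsCoatom X) : IsCoatom (X.map f) := by
  have hcomap : (X.map f).comap f = X := comap_map_eq_self hker
  refine ⟨fun htop => hX.1 ?_, fun K hK => ?_⟩
  · rw [← hcomap, htop, comap_top]
  · have hlt : X < K.comap f := hcomap ▸ (comap_lt_comap_of_surjective hf).2 hK
    rw [← map_comap_eq_self_of_surjective hf K, hX.2 _ hlt, map_top_of_surjective f hf]

theorem map_commutator_of_surjective (hf : Function.Surjective f) :
    (commutator G).map f = commutator H := by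
  rw [commutator_def, commutator_def, map_commutator, map_top_of_surjective f hf]

theorem commutator_sup_ne_top [Group.IsSolvable G] {N : Subgroup G} [N.Normal] (hN : N ≠ ⊤) :
    commutator G ⊔ N ≠ ⊤ := by
  intro htop
  have := QuotientGroup.nontrivial_iff.2 hN
  have hmap := congrArg (map (QuotientGroup.mk' N)) htop
  rw [Subgroup.map_sup, map_commutator_of_surjective (QuotientGroup.mk'_surjective N),
    QuotientGroup.map_mk'_self, sup_bot_eq,
    map_top_of_surjective _ (QuotientGroup.mk'_surjective N)] at hmap
  exact (Group.IsSolvable.commutator_lt_top_of_nontrivial (G ⧸ N)).ne hmap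

theorem normalCore_ne_top {X : Subgroup G} (hX : X ≠ ⊤) : X.normalCore ≠ ⊤ :=
  fun htop => hX (top_le_iff.1 (htop ▸ X.normalCore_le))

theorem ker_mk'_normalCore_le (X : Subgroup G) : (QuotientGroup.mk' X.normalCore).ker ≤ X :=
  (QuotientGroup.ker_mk' _).trans_le X.normalCore_le

theorem index_map_mk'_normalCore (X : Subgroup G) :
    (X.map (QuotientGroup.mk' X.normalCore)).index = X.index :=
  index_map_eq X (QuotientGroup.mk'_surjective _) (ker_mk'_normalCore_le X)

theorem comap_map_mk'_normalCore (X : Subgroup G) :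
    (X.map (QuotientGroup.mk' X.normalCore)).comap (QuotientGroup.mk' X.normalCore) = X :=
  comap_map_eq_self (ker_mk'_normalCore_le X)

theorem normalCore_map_mk'_normalCore (X : Subgroup G) :
    (X.map (QuotientGroup.mk' X.normalCore)).normalCore = ⊥ := by
  have hsurj := QuotientGroup.mk'_surjective X.normalCore
  have hle : (X.map (QuotientGroup.mk' X.normalCore)).normalCore.comap
      (QuotientGroup.mk' X.normalCore) ≤ X.normalCore :=
    normal_le_normalCore.2
      ((comap_mono (normalCore_le _)).trans (comap_map_mk'_normalCore X).le)
  rw [← map_comap_eq_self_of_surjective hsurj (X.map (QuotientGroup.mk' X.normalCore)).normalCore,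
    Subgroup.map_eq_bot_iff, QuotientGroup.ker_mk']
  exact hle

end Quotients

/-- Every maximal subgroup contains an element lying in no other maximal subgroup: the maximal
subgroups form an irredundant family. -/
def MaximalSubgroupsIrredundant (G : Type*) [Group G] : Prop :=
  ∀ M : Subgroup G, IsCoatom M → ∃ g ∈ M, ∀ M' : Subgroup G, IsCoatom M' → g ∈ M' → M' = M

theorem maximalSubgroupsIrredundant_of_numMaximalSubgroups_le {G : Type*} [Group G] [Finite G]
    (hcyc : ¬ IsCyclic G) (hσ : numMaximalSubgroups G ≤ coveringNumber G) :
    MaximalSubgroupsIrredundant G := by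
  intro M hM
  by_contra! hcon
  let C := {K : Subgroup G // IsCoatom K ∧ K ≠ M}
  have hcov (g : G) : ∃ K : C, g ∈ K.1 := by
    have hz : zpowers g ≠ ⊤ := fun h => hcyc (isCyclic_iff_exists_zpowers_eq_top.2 ⟨g, h⟩)
    obtain ⟨K, hK, hgK⟩ := (eq_top_or_exists_le_coatom (zpowers g)).resolve_left hz
    have hg : g ∈ K := hgK (mem_zpowers g)
    by_cases hKM : K = M
    · obtain ⟨K', hK', hg', hne⟩ := hcon g (hKM ▸ hg)
      exact ⟨⟨K', hK', hne⟩, hg'⟩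
    · exact ⟨⟨K, hK, hKM⟩, hg⟩
  have hCpos : 0 < Nat.card C := Nat.card_pos_iff.2 ⟨(hcov 1).nonempty, inferInstance⟩
  have hle : coveringNumber G ≤ Nat.card C := by
    refine Nat.sInf_le ⟨hCpos, fun i => ((Finite.equivFin C).symm i).1,
      fun i => ((Finite.equivFin C).symm i).2.1.1, Set.eq_univ_of_forall fun g => ?_⟩
    obtain ⟨K, hK⟩ := hcov g
    exact Set.mem_iUnion.2 ⟨Finite.equivFin C K, by simpa using hK⟩
  have hlt : Nat.card C < numMaximalSubgroups G :=
    Set.ncard_lt_ncard (s := {K : Subgroup G | IsCoatom K ∧ K ≠ M})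
      (t := {K : Subgroup G | IsCoatom K}) ⟨fun _ h => h.1, fun h => (h hM).2 rfl⟩
  exact (hle.trans_lt hlt).not_ge hσ

theorem exists_isCoatom_not_normal {G : Type*} [Group G] [Finite G]
    (hnil : ¬ Group.IsNilpotent G) : ∃ X : Subgroup G, IsCoatom X ∧ ¬ X.Normal := by
  by_contra! hnormal
  exact hnil ((Group.isNilpotent_of_finite_tfae.out 2 0).1 hnormal)

namespace MaximalSubgroupsIrredundant

variable {G : Type*} [Group G] {X : Subgroup G}

theorem commutator_commutator_le [IsCoatomic (Subgroup G)] [Group.IsSolvable G]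
    (h : MaximalSubgroupsIrredundant G) (hX : IsCoatom X) (hn : ¬ X.Normal) :
    ⁅commutator G, commutator G⁆ ≤ X := by
  obtain ⟨g, -, hu⟩ := h X hX
  have hne : ⁅commutator G, commutator G⁆ ⊔ zpowers g ≠ ⊤ := by
    intro htop
    have hle : commutator G ≤ ⁅commutator G, commutator G⁆ :=
      Normal.commutator_le_of_self_sup_commutative_eq_top htop inferInstance
    have hbot : commutator G ≠ ⊥ := fun hbot =>
      hn (Subgroup.Normal.of_commutator_le _ (hbot.trans_le bot_le))
    exact (Group.IsSolvable.commutator_lt_of_ne_bot hbot).not_ge hle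
  obtain ⟨Y, hY, hle⟩ := (eq_top_or_exists_le_coatom _).resolve_left hne
  rw [← hu Y hY (hle (mem_sup_right (mem_zpowers g)))]
  exact le_sup_left.trans hle

theorem isAffinePrimitive [IsCoatomic (Subgroup G)] [Group.IsSolvable G]
    (h : MaximalSubgroupsIrredundant G) (hX : IsCoatom X) (hn : ¬ X.Normal) :
    IsAffinePrimitive (commutator (G ⧸ X.normalCore))
      (X.map (QuotientGroup.mk' X.normalCore)) where
  normal := inferInstance
  isMulCommutative := by
    rw [← commutator_self_eq_bot_iff,
      ← map_commutator_of_surjective (QuotientGroup.mk'_surjective X.normalCore), ← map_commutator,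
      Subgroup.map_eq_bot_iff, QuotientGroup.ker_mk', normal_le_normalCore]
    exact h.commutator_commutator_le hX hn
  ne_bot := by
    rw [← map_commutator_of_surjective (QuotientGroup.mk'_surjective X.normalCore), Ne,
      Subgroup.map_eq_bot_iff, QuotientGroup.ker_mk', normal_le_normalCore]
    exact fun hle => hn (Subgroup.Normal.of_commutator_le _ hle)
  isCoatom :=
    isCoatom_map_of_surjective (QuotientGroup.mk'_surjective _) (ker_mk'_normalCore_le X) hX
  normalCore_eq_bot := normalCore_map_mk'_normalCore X

theorem exists_mem_conjAct_smul [Finite G] [Group.IsSolvable G]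
    (h : MaximalSubgroupsIrredundant G) (hX : IsCoatom X) (hn : ¬ X.Normal) {y : G}
    (hy : y ∉ commutator G ⊔ X.normalCore) : ∃ t : ConjAct G, y ∈ t • X := by
  let π := QuotientGroup.mk' X.normalCore
  have hsurj : Function.Surjective π := QuotientGroup.mk'_surjective X.normalCore
  have hprim := h.isAffinePrimitive hX hn
  have := hprim.isMulCommutative_right le_rfl
  have hπy : π y ∉ commutator (G ⧸ X.normalCore) := by
    rwa [← map_commutator_of_surjective hsurj, ← mem_comap, comap_map_eq, QuotientGroup.ker_mk']
  obtain ⟨t, ht⟩ := hprim.exists_mem_conjAct_smul hπy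
  obtain ⟨s, hs⟩ := hsurj (ConjAct.ofConjAct t)
  obtain rfl : ConjAct.toConjAct (π s) = t := hs
  refine ⟨ConjAct.toConjAct s, ?_⟩
  rw [mem_pointwise_smul_iff_inv_smul_mem] at ht ⊢
  rw [← comap_map_mk'_normalCore X]
  exact ht

theorem exists_setOf_isCoatom_eq [Finite G] [Group.IsSolvable G]
    (h : MaximalSubgroupsIrredundant G) (hX : IsCoatom X) (hn : ¬ X.Normal) :
    ∃ M : Subgroup G, M.Normal ∧ X.normalCore ≤ M ∧
      {Y : Subgroup G | IsCoatom Y} = insert M (orbit (ConjAct G) X) := by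
  obtain ⟨M, hM, hle⟩ :=
    (eq_top_or_exists_le_coatom _).resolve_left
      (commutator_sup_ne_top (normalCore_ne_top hX.1))
  refine ⟨M, Subgroup.Normal.of_commutator_le _ (le_sup_left.trans hle), le_sup_right.trans hle,
    Set.Subset.antisymm (fun Y hY => ?_) (Set.insert_subset hM ?_)⟩
  · obtain ⟨y, -, hu⟩ := h Y hY
    by_cases hy : y ∈ commutator G ⊔ X.normalCore
    · exact Or.inl (hu M hM (hle hy)).symm
    · obtain ⟨t, ht⟩ := h.exists_mem_conjAct_smul hX hn hy
      exact Or.inr ⟨t, hu _ (isCoatom_conjAct_smul hX t) ht⟩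
  · rintro _ ⟨t, rfl⟩
    exact isCoatom_conjAct_smul hX t

theorem frattini_eq_normalCore [Finite G] [Group.IsSolvable G]
    (h : MaximalSubgroupsIrredundant G) (hX : IsCoatom X) (hn : ¬ X.Normal) :
    frattini G = X.normalCore := by
  obtain ⟨M, -, hle, hset⟩ := h.exists_setOf_isCoatom_eq hX hn
  refine le_antisymm (normal_le_normalCore.2 (frattini_le_coatom hX)) (le_iInf₂ fun Y hY => ?_)
  rcases hset.subset hY with rfl | ⟨t, rfl⟩
  · exact hle
  · rw [normalCore_eq_iInf_conjAct]
    exact iInf_le _ t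

theorem numMaximalSubgroups_eq [Finite G] [Group.IsSolvable G]
    (h : MaximalSubgroupsIrredundant G) (hX : IsCoatom X) (hn : ¬ X.Normal) :
    numMaximalSubgroups G = X.index + 1 := by
  obtain ⟨M, hM, -, hset⟩ := h.exists_setOf_isCoatom_eq hX hn
  have hMX : M ∉ orbit (ConjAct G) X := fun hmem => hn (eq_of_mem_orbit_conjAct hmem ▸ hM)
  rw [← ncard_orbit_conjAct_of_isCoatom hX hn, ← Set.ncard_insert_of_notMem hMX, ← hset]
  rfl

theorem existsUnique_isCoatom_of_surjective [Finite G] [Group.IsSolvable G] {A : Type*}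
    [CommGroup A] [Nontrivial A] (h : MaximalSubgroupsIrredundant G) (hX : IsCoatom X)
    (hn : ¬ X.Normal) {f : G →* A} (hf : Function.Surjective f) :
    ∃! K : Subgroup A, IsCoatom K := by
  obtain ⟨M, -, -, hset⟩ := h.exists_setOf_isCoatom_eq hX hn
  have hcomap {K : Subgroup A} (hK : IsCoatom K) : K.comap f = M := by
    refine (hset.subset (isCoatom_comap_of_surjective hf hK)).resolve_right fun hmem => hn ?_
    exact eq_of_mem_orbit_conjAct hmem ▸ inferInstance
  have := Finite.of_surjective f hf
  obtain ⟨K, hK, -⟩ := (eq_top_or_exists_le_coatom (⊥ : Subgroup A)).resolve_left bot_ne_top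
  exact ⟨K, hK, fun L hL => comap_injective hf ((hcomap hL).trans (hcomap hK).symm)⟩

theorem exists_zmod_mulEquiv [Finite G] [Group.IsSolvable G] (h : MaximalSubgroupsIrredundant G)
    (hX : IsCoatom X) (hn : ¬ X.Normal) :
    ∃ p α : ℕ, p.Prime ∧ 0 < α ∧ Nonempty
      (Multiplicative (ZMod (p ^ α)) ≃* X.map (QuotientGroup.mk' X.normalCore)) := by
  have hprim := h.isAffinePrimitive hX hn
  have := QuotientGroup.nontrivial_iff.2 (normalCore_ne_top hX.1)
  have : Nontrivial (Abelianization (G ⧸ X.normalCore)) := QuotientGroup.nontrivial_iff.2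
    (Group.IsSolvable.commutator_lt_top_of_nontrivial (G ⧸ X.normalCore)).ne
  have huniq : ∃! K : Subgroup (Abelianization (G ⧸ X.normalCore)), IsCoatom K :=
    h.existsUnique_isCoatom_of_surjective hX hn
      (f := Abelianization.of.comp (QuotientGroup.mk' X.normalCore))
      ((QuotientGroup.mk'_surjective _).comp (QuotientGroup.mk'_surjective _))
  obtain ⟨p, α, hp, hα, ⟨e⟩⟩ := exists_zmod_mulEquiv_of_existsUnique_isCoatom huniq
  exact ⟨p, α, hp, hα, ⟨e.trans hprim.isComplement'.symm.QuotientMulEquiv⟩⟩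

end MaximalSubgroupsIrredundant

theorem lemma3p2 (G : Type u) [Group G] [Finite G] [Group.IsSolvable G]
    (hnil : ¬ Group.IsNilpotent G)
    (hσ : coveringNumber G = numMaximalSubgroups G) :
    coveringNumber G ≠ 3 ∧
      ∃ (E : Type u) (_ : Group E) (p α : ℕ)
        (φ : Multiplicative (ZMod (p ^ α)) →* MulAut E),
        IsElementaryAbelian E ∧ Nat.card E + 1 = coveringNumber G ∧
        p.Prime ∧ 0 < α ∧ Function.Injective φ ∧
        Nonempty (G ⧸ frattini G ≃* E ⋊[φ] Multiplicative (ZMod (p ^ α))) := by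
  have hcyc : ¬ IsCyclic G := fun hcyc => hnil (@CommGroup.isNilpotent G IsCyclic.commGroup)
  have hirr := maximalSubgroupsIrredundant_of_numMaximalSubgroups_le hcyc hσ.ge
  obtain ⟨X, hX, hn⟩ := exists_isCoatom_not_normal hnil
  have hprim := hirr.isAffinePrimitive hX hn
  have hσX : coveringNumber G = X.index + 1 := hσ.trans (hirr.numMaximalSubgroups_eq hX hn)
  have hcard : Nat.card (commutator (G ⧸ X.normalCore)) = X.index :=
    hprim.card_eq_index.trans (index_map_mk'_normalCore X)
  obtain ⟨p, α, hp, hα, ⟨e⟩⟩ := hirr.exists_zmod_mulEquiv hX hn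
  obtain ⟨φ, hφ, ⟨f⟩⟩ := hprim.exists_semidirectProduct e
  refine ⟨fun h3 => hn (normal_of_index_eq_two (by omega)), commutator (G ⧸ X.normalCore),
    inferInstance, p, α, φ, hprim.isElementaryAbelian, by omega, hp, hα, hφ,
    ⟨(QuotientGroup.quotientMulEquivOfEq (hirr.frattini_eq_normalCore hX hn)).trans f⟩⟩
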